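/- Let $W$ be the affine Weyl group of type $\tilde A_2$, i.e. the Coxeter group generated by three simple reflections $s_0,s_1,s_2$ subject to the relations $s_i^2=1$ and $(s_is_j)^3=1$ for $i\neq j$. Let $\ell$ be the length function with respect to $s_0,s_1,s_2$, call the conjugates in $W$ of the $s_i$ the reflections, and let $\leq$ be the Bruhat order on $W$, that is, the partial order generated by the relations $u<ru$ where $r$ is a reflection and $\ell(u)<\ell(ru)$. An element of $W$ is called spiral if it has a reduced expression of the form $s_is_js_ks_is_js_ks_i\cdots$ (of any finite length $\ge 0$) with $i,j,k$ distinct. For $x,w\in W$ with $x\leq w$ put $$q^w_x=\#\{\,r\in W : r \text{ is a reflection and } rx\leq w\,\}-\ell(w).$$ Let $w\in W$ be non-spiral, and let $x,y\in W$ with $y\leq x\leq w$. If $q^w_x>0$, then $q^w_y>0$. -/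

import Mathlib

namespace AffineA2

/-- The Coxeter matrix of type `Ã₂`: three simple reflections `s₀, s₁, s₂`, any two distinct ones
having a product of order `3`. -/
def matrix : CoxeterMatrix (Fin 3) where
  M := !![1, 3, 3;
          3, 1, 3;
          3, 3, 1]
  isSymm := by decide
  diagonal := by decide
  off_diagonal i j h := by fin_cases i <;> fin_cases j <;> simp_all

end AffineA2

namespace CoxeterSystem

variable {B : Type*} {W : Type*} [Group W] {M : CoxeterMatrix B} (cs : CoxeterSystem M W)

/-- The Bruhat order: `cs.BruhatLE x w` means `x ≤ w`. It is the partial order generated by the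
relations `u < r u`, where `r` is a reflection and `ℓ(u) < ℓ(r u)`. -/
def BruhatLE : W → W → Prop :=
  Relation.ReflTransGen fun u v =>
    ∃ r : W, cs.IsReflection r ∧ v = r * u ∧ cs.length u < cs.length (r * u)

theorem BruhatLE.length_le {cs : CoxeterSystem M W} {x w : W} (h : cs.BruhatLE x w) :
    cs.length x ≤ cs.length w := by
  induction h with
  | refl => exact le_rfl
  | tail _ h ih =>
    obtain ⟨r, _, rfl, hlt⟩ := h
    exact ih.trans hlt.le

/-- The set of reflections `r` with `r x ≤ w`. -/
def reflectionsBelow (w x : W) : Set W :=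
  {r | cs.IsReflection r ∧ cs.BruhatLE (r * x) w}

/-- If there are finitely many simple reflections then `reflectionsBelow` is finite, so that its
`Set.ncard` is the true number of elements. -/
theorem finite_reflectionsBelow [Finite B] (w x : W) : (cs.reflectionsBelow w x).Finite := by
  have h1 : (cs.wordProd '' {l : List B | l.length ≤ cs.length w}).Finite :=
    (List.finite_length_le B (cs.length w)).image _
  refine Set.Finite.of_finite_image (f := fun r => r * x) (h1.subset ?_)
    (mul_left_injective x).injOn
  rintro _ ⟨r, hr, rfl⟩
  obtain ⟨l, hl, hw⟩ := cs.exists_isReduced (r * x)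
  refine ⟨l, ?_, hw.symm⟩
  have h2 := hr.2.length_le
  rwa [hw, hl] at h2

/-- `q^w_x`: the number of reflections `r` with `r x ≤ w`, minus `ℓ(w)` (an integer). -/
noncomputable def q (w x : W) : ℤ :=
  ((cs.reflectionsBelow w x).ncard : ℤ) - (cs.length w : ℤ)

end CoxeterSystem

namespace AffineA2

/-- The word `i j k i j k i …` of length `n`. -/
def spiralWord (i j k : Fin 3) : ℕ → List (Fin 3)
  | 0 => []
  | n + 1 => i :: spiralWord j k i n

/-- An element is spiral if it has a reduced expression `sᵢ sⱼ sₖ sᵢ sⱼ sₖ sᵢ …` (of any length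
`n ≥ 0`) with `i, j, k` distinct. -/
def IsSpiral {W : Type*} [Group W] (cs : CoxeterSystem matrix W) (w : W) : Prop :=
  ∃ (i j k : Fin 3) (n : ℕ), i ≠ j ∧ j ≠ k ∧ i ≠ k ∧
    cs.IsReduced (spiralWord i j k n) ∧ cs.wordProd (spiralWord i j k n) = w

end AffineA2

namespace AffineA2

/-! The group acts simply transitively on the alcoves of the `Ã₂` arrangement, so elements become
integer triples, length becomes `norm`, and length and Bruhat order become linear arithmetic
(`length_eq_norm`, `bruhatLE_iff`, `q_eq`). Spiral elements account for all alcoves with a zero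
coordinate. For a non-spiral `w` two coordinates therefore share a sign, and after a rotation they
are `a` and `b`.

In both sign cases the alcoves below `w` fill an explicit hexagon (`le_iff_negHexagon`,
`le_iff_posHexagon`). A reflection in family `i` moves an alcove along a chord of the hexagon, so
the reflections keeping `x` below `w` are counted by the lengths of the three chords through `x`. It
suffices to descend by one reflection. That reflection fixes one chord and exchanges the positions
of the other two.

For `w.a, w.b < 0` chord length is a rounded tent function of position, and the count never drops on
descent (`numReflections_le_of_neg`). For `w.a, w.b > 0` two of the three profiles have a plateau,
and when the coordinates of `w` sum to `-1` rounding costs one reflection near the centre. The count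
may then drop by one, so `q` itself is not monotone. Its positivity still passes down
(`lt_chordSum_of_short`, `lt_chordSum_of_long`). -/

/-- An alcove of the affine `A₂` arrangement, given by the integer parts of the three affine
coordinates `α₁`, `α₂`, `1 - α₁ - α₂` (which add up to `1`) on it. -/
@[ext]
structure Alcove where
  a : ℤ
  b : ℤ
  d : ℤ
  sum_eq : a + b + d = 0 ∨ a + b + d = -1

namespace Alcove

/-- The fundamental alcove. -/
def base : Alcove := ⟨0, 0, 0, by decide⟩

/-- The reflection of alcoves in the hyperplane where the `i`-th coordinate is `m`. -/
def reflect : Fin 3 → ℤ → Alcove → Alcove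
  | 0, m, x => ⟨2 * m - 1 - x.a, -x.d - m, -x.b - m, by have := x.sum_eq; omega⟩
  | 1, m, x => ⟨-x.d - m, 2 * m - 1 - x.b, -x.a - m, by have := x.sum_eq; omega⟩
  | 2, m, x => ⟨-x.b - m, -x.a - m, 2 * m - 1 - x.d, by have := x.sum_eq; omega⟩

/-- The number of hyperplanes separating an alcove from the fundamental one. -/
def norm (x : Alcove) : ℕ := x.a.natAbs + x.b.natAbs + x.d.natAbs

theorem reflect_reflect (i : Fin 3) (m : ℤ) (x : Alcove) : reflect i m (reflect i m x) = x := by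
  fin_cases i <;> ext <;> simp [reflect]

/-- A reflection as a permutation of the alcoves. -/
def reflectPerm (i : Fin 3) (m : ℤ) : Equiv.Perm Alcove where
  toFun := reflect i m
  invFun := reflect i m
  left_inv := reflect_reflect i m
  right_inv := reflect_reflect i m

@[simp]
theorem reflectPerm_apply (i : Fin 3) (m : ℤ) (x : Alcove) :
    reflectPerm i m x = reflect i m x := rfl

theorem reflectPerm_inv (i : Fin 3) (m : ℤ) : (reflectPerm i m)⁻¹ = reflectPerm i m := rfl

theorem reflect_braid {i j : Fin 3} (h : i ≠ j) (x : Alcove) :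
    reflect i 0 (reflect j 0 (reflect i 0 x)) = reflect j 0 (reflect i 0 (reflect j 0 x)) := by
  fin_cases i <;> fin_cases j <;> first | exact absurd rfl h | (ext <;> simp [reflect] <;> omega)

theorem matrix_apply (i j : Fin 3) : matrix.M i j = if i = j then 1 else 3 := by
  fin_cases i <;> fin_cases j <;> rfl

theorem isLiftable : matrix.IsLiftable fun i => reflectPerm i 0 := by
  intro i j
  rw [matrix_apply]
  ext1 x
  split_ifs with h
  · subst h
    simp [reflect_reflect]
  · simp only [pow_succ, pow_zero, one_mul, Equiv.Perm.mul_apply, reflectPerm_apply,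
      Equiv.Perm.one_apply]
    rw [reflect_braid h]
    simp only [reflect_reflect]

theorem norm_base : base.norm = 0 := rfl

theorem eq_base_of_norm_eq_zero {x : Alcove} (h : x.norm = 0) : x = base := by
  simp only [norm] at h
  ext <;> simp only [base] <;> omega

theorem norm_simple_reflect (i : Fin 3) (x : Alcove) :
    (reflect i 0 x).norm = x.norm + 1 ∨ (reflect i 0 x).norm + 1 = x.norm := by
  have := x.sum_eq
  fin_cases i <;> simp only [reflect, norm] <;> omega

theorem exists_norm_simple_reflect_lt {x : Alcove} (h : x.norm ≠ 0) :
    ∃ i, (reflect i 0 x).norm < x.norm := by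
  by_contra! hc
  have h0 := hc 0
  have h1 := hc 1
  have h2 := hc 2
  have := x.sum_eq
  simp only [reflect, norm] at h h0 h1 h2
  omega

/-- The local confluence behind `Reaches.unique`: two different descents from `x` both continue down
to the bottom of one braid hexagon. -/
theorem norm_braid {i j : Fin 3} (hij : i ≠ j) {x : Alcove} (hi : (reflect i 0 x).norm < x.norm)
    (hj : (reflect j 0 x).norm < x.norm) :
    (reflect j 0 (reflect i 0 x)).norm < (reflect i 0 x).norm ∧
      (reflect i 0 (reflect j 0 (reflect i 0 x))).norm < (reflect j 0 (reflect i 0 x)).norm := by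
  have := x.sum_eq
  fin_cases i <;> fin_cases j <;> first | exact absurd rfl hij |
    (simp only [reflect, norm] at *; omega)

/-- The `i`-th coordinate of an alcove. -/
def coord (x : Alcove) (i : Fin 3) : ℤ := ![x.a, x.b, x.d] i

/-- A reflection increases the norm iff its hyperplane does not separate the alcove from the
fundamental one. -/
theorem norm_lt_norm_reflect_iff (i : Fin 3) (m : ℤ) (x : Alcove) :
    x.norm < (reflect i m x).norm ↔ m ≤ 0 ∧ m ≤ x.coord i ∨ 0 < m ∧ x.coord i < m := by
  have := x.sum_eq
  fin_cases i <;> simp [reflect, norm, coord] <;> omega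

end Alcove

/-! ### Simple transitivity on alcoves, and length as `norm`. -/

open Alcove

variable {W : Type*} [Group W] (cs : CoxeterSystem matrix W)

/-- The action of the affine Weyl group on alcoves. -/
noncomputable def action : W →* Equiv.Perm Alcove :=
  cs.lift ⟨fun i => reflectPerm i 0, isLiftable⟩

theorem action_simple (i : Fin 3) : action cs (cs.simple i) = reflectPerm i 0 :=
  cs.lift_apply_simple isLiftable i

/-- The alcove `w A₀`, where `A₀` is the fundamental alcove. -/
noncomputable def alcove (w : W) : Alcove := action cs w base

theorem alcove_one : alcove cs 1 = base := by simp [alcove]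

theorem alcove_mul (u v : W) : alcove cs (u * v) = action cs u (alcove cs v) := by
  simp [alcove]

theorem alcove_simple_mul (i : Fin 3) (w : W) :
    alcove cs (cs.simple i * w) = reflect i 0 (alcove cs w) := by
  simp [alcove_mul, action_simple]

theorem simple_braid {i j : Fin 3} (h : i ≠ j) (w : W) :
    cs.simple i * (cs.simple j * (cs.simple i * w)) =
      cs.simple j * (cs.simple i * (cs.simple j * w)) := by
  have h1 := cs.simple_mul_simple_pow i j
  rw [matrix_apply, if_neg h] at h1
  have h2 : cs.simple i * cs.simple j * cs.simple i * (cs.simple j * cs.simple i * cs.simple j)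
      = 1 := by
    rw [← h1]; simp only [pow_succ, pow_zero, one_mul, mul_assoc]
  have h3 := eq_inv_of_mul_eq_one_left h2
  simp only [mul_inv_rev, cs.inv_simple] at h3
  simp only [← mul_assoc] at h3 ⊢
  rw [h3]

/-- `Reaches cs x w` says that `w` is a product of simple reflections along a minimal gallery from
the fundamental alcove to `x`. -/
inductive Reaches : Alcove → W → Prop
  | base : Reaches Alcove.base 1
  | step {x : Alcove} {w : W} (i : Fin 3) : (reflect i 0 x).norm < x.norm →
      Reaches (reflect i 0 x) w → Reaches x (cs.simple i * w)

variable {cs}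

theorem exists_reaches (x : Alcove) : ∃ w, Reaches cs x w := by
  induction hn : x.norm using Nat.strong_induction_on generalizing x with
  | _ n ih =>
    subst hn
    by_cases h0 : x.norm = 0
    · rw [eq_base_of_norm_eq_zero h0]
      exact ⟨1, .base⟩
    · obtain ⟨i, hi⟩ := exists_norm_simple_reflect_lt h0
      obtain ⟨w, hw⟩ := ih _ hi _ rfl
      exact ⟨_, .step i hi hw⟩

theorem Reaches.step' {x : Alcove} {w : W} (h : Reaches cs x w) (i : Fin 3)
    (hi : x.norm < (reflect i 0 x).norm) : Reaches cs (reflect i 0 x) (cs.simple i * w) :=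
  .step i (by rwa [reflect_reflect]) (by rwa [reflect_reflect])

theorem Reaches.eq_one {w : W} (h : Reaches cs Alcove.base w) : w = 1 := by
  generalize hx : Alcove.base = x at h
  cases h with
  | base => rfl
  | step i hi _ =>
    subst hx
    simp [norm_base] at hi

/-- A diamond argument: if two galleries start with different descents, both can be rerouted by
induction through the common alcove of `norm_braid`, where the braid relation in `W` identifies
them. This gives faithfulness of the action. -/
theorem Reaches.unique {x : Alcove} {w w' : W} (h : Reaches cs x w) (h' : Reaches cs x w') :
    w = w' := by
  induction hn : x.norm using Nat.strong_induction_on generalizing x w w' with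
  | _ n ih =>
    subst hn
    cases h with
    | base => exact h'.eq_one.symm
    | @step _ u i hi hu =>
      cases h' with
      | base => simp [norm_base] at hi
      | @step _ v j hj hv =>
        by_cases hij : i = j
        · subst hij
          rw [ih _ hi hu hv rfl]
        · obtain ⟨t, ht⟩ := exists_reaches (cs := cs) (reflect i 0 (reflect j 0 (reflect i 0 x)))
          have h1 := norm_braid hij hi hj
          have h2 := norm_braid (Ne.symm hij) hj hi
          have ht' := ht
          rw [reflect_braid hij] at ht'
          have hu' : Reaches cs (reflect i 0 x) (cs.simple j * (cs.simple i * t)) :=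
            .step j h1.1 (.step i h1.2 ht)
          have hv' : Reaches cs (reflect j 0 x) (cs.simple i * (cs.simple j * t)) :=
            .step i h2.1 (.step j h2.2 ht')
          rw [ih _ hi hu hu' rfl, ih _ hj hv hv' rfl, simple_braid cs hij]

theorem Reaches.simple_mul {x : Alcove} {w : W} (h : Reaches cs x w) (i : Fin 3) :
    Reaches cs (reflect i 0 x) (cs.simple i * w) := by
  rcases norm_simple_reflect i x with hi | hi
  · exact h.step' i (by omega)
  · obtain ⟨v, hv⟩ := exists_reaches (cs := cs) (reflect i 0 x)
    have := h.unique (.step i (by omega) hv)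
    rw [this, cs.simple_mul_simple_cancel_left]
    exact hv

variable (cs) in
theorem reaches_alcove (w : W) : Reaches cs (alcove cs w) w := by
  induction w using cs.simple_induction_left with
  | one => rw [alcove_one]; exact .base
  | mul_simple_left w i ih => rw [alcove_simple_mul]; exact ih.simple_mul i

variable (cs) in
theorem alcove_injective : Function.Injective (alcove cs) := by
  intro u v h
  have := reaches_alcove cs u
  rw [h] at this
  exact this.unique (reaches_alcove cs v)

theorem Reaches.length_le {x : Alcove} {w : W} (h : Reaches cs x w) : cs.length w ≤ x.norm := by
  induction h with
  | base => simp
  | @step x w i hi _ ih =>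
    have := cs.length_mul_le (cs.simple i) w
    rw [cs.length_simple] at this
    omega

variable (cs) in
theorem norm_alcove_wordProd_le (l : List (Fin 3)) :
    (alcove cs (cs.wordProd l)).norm ≤ l.length := by
  induction l with
  | nil => simp [alcove_one, norm_base]
  | cons i l ih =>
    rw [cs.wordProd_cons, alcove_simple_mul, List.length_cons]
    have := norm_simple_reflect i (alcove cs (cs.wordProd l))
    omega

variable (cs) in
theorem length_eq_norm (w : W) : cs.length w = (alcove cs w).norm := by
  refine le_antisymm (reaches_alcove cs w).length_le ?_
  obtain ⟨l, hl, rfl⟩ := cs.exists_isReduced w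
  rw [hl.eq]
  exact norm_alcove_wordProd_le cs l

/-! ### Reflections -/

theorem conj_reflectPerm_self (i : Fin 3) (m : ℤ) :
    reflectPerm i 0 * reflectPerm i m * (reflectPerm i 0)⁻¹ = reflectPerm i (-m) := by
  rw [reflectPerm_inv]
  ext1 x
  fin_cases i <;> ext <;> simp [reflect] <;> omega

theorem conj_reflectPerm {i j k : Fin 3} (hij : i ≠ j) (hik : i ≠ k) (hjk : j ≠ k) (m : ℤ) :
    reflectPerm j 0 * reflectPerm i m * (reflectPerm j 0)⁻¹ = reflectPerm k (1 - m) := by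
  rw [reflectPerm_inv]
  ext1 x
  fin_cases i <;> fin_cases j <;> first | exact absurd rfl hij | skip
  all_goals fin_cases k <;> first | exact absurd rfl hik | exact absurd rfl hjk | skip
  all_goals ext <;> simp [reflect] <;> omega

theorem exists_action_eq_reflectPerm {r : W} (hr : cs.IsReflection r) :
    ∃ i m, action cs r = reflectPerm i m := by
  obtain ⟨w, i, rfl⟩ := hr
  induction w using cs.simple_induction_left with
  | one => exact ⟨i, 0, by simp [action_simple]⟩
  | mul_simple_left w j ih =>
    obtain ⟨k, m, h⟩ := ih
    have h1 : cs.simple j * w * cs.simple i * (cs.simple j * w)⁻¹ =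
      cs.simple j * (w * cs.simple i * w⁻¹) * (cs.simple j)⁻¹ := by group
    rw [h1, map_mul, map_mul, map_inv, h, action_simple]
    by_cases hkj : k = j
    · subst hkj
      exact ⟨_, _, conj_reflectPerm_self k m⟩
    · obtain ⟨l, hkl, hjl⟩ : ∃ l, k ≠ l ∧ j ≠ l :=
        (by decide : ∀ k j : Fin 3, ∃ l, k ≠ l ∧ j ≠ l) k j
      exact ⟨_, _, conj_reflectPerm hkj hkl hjl m⟩

variable (cs) in
theorem exists_isReflection (i : Fin 3) (m : ℤ) :
    ∃ r, cs.IsReflection r ∧ action cs r = reflectPerm i m := by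
  have conj_self {i : Fin 3} {m : ℤ}
      (h : ∃ r, cs.IsReflection r ∧ action cs r = reflectPerm i m) :
      ∃ r, cs.IsReflection r ∧ action cs r = reflectPerm i (-m) := by
    obtain ⟨r, hr, h⟩ := h
    refine ⟨_, hr.conj (cs.simple i), ?_⟩
    rw [map_mul, map_mul, map_inv, h, action_simple, conj_reflectPerm_self]
  have conj_ne {i : Fin 3} {m : ℤ} (j k : Fin 3) (hij : i ≠ j) (hik : i ≠ k) (hjk : j ≠ k)
      (h : ∃ r, cs.IsReflection r ∧ action cs r = reflectPerm i m) :
      ∃ r, cs.IsReflection r ∧ action cs r = reflectPerm k (1 - m) := by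
    obtain ⟨r, hr, h⟩ := h
    refine ⟨_, hr.conj (cs.simple j), ?_⟩
    rw [map_mul, map_mul, map_inv, h, action_simple, conj_reflectPerm hij hik hjk]
  have simple (i : Fin 3) : ∃ r, cs.IsReflection r ∧ action cs r = reflectPerm i 0 :=
    ⟨_, cs.isReflection_simple i, action_simple cs i⟩
  have nat (n : ℕ) : ∃ r, cs.IsReflection r ∧ action cs r = reflectPerm 0 n := by
    induction n using Nat.strong_induction_on with
    | _ n ih =>
      match n with
      | 0 => exact simple 0
      | 1 => exact conj_ne 1 0 (by decide) (by decide) (by decide) (simple 2)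
      | n + 2 =>
        -- Going from family `0` to family `2` and back, with a sign change before each passage,
        -- raises the level by `2`; hence the two base cases.
        have e : ((n + 2 : ℕ) : ℤ) = 1 - -(1 - -(n : ℤ)) := by push_cast; ring
        rw [e]
        exact conj_ne 1 0 (by decide) (by decide) (by decide)
          (conj_self (conj_ne 1 2 (by decide) (by decide) (by decide)
            (conj_self (ih n (by omega)))))
  have zero (m : ℤ) : ∃ r, cs.IsReflection r ∧ action cs r = reflectPerm 0 m := by
    obtain ⟨n, rfl | rfl⟩ := m.eq_nat_or_neg
    · exact nat n
    · exact conj_self (nat n)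
  fin_cases i
  · exact zero m
  · have h := conj_ne 2 1 (by decide) (by decide) (by decide) (zero (1 - m))
    rwa [sub_sub_cancel] at h
  · have h := conj_ne 1 2 (by decide) (by decide) (by decide) (zero (1 - m))
    rwa [sub_sub_cancel] at h

/-! ### Bruhat order and reflection counts on alcoves. -/

namespace Alcove

/-- The Bruhat order on alcoves. -/
def LE : Alcove → Alcove → Prop :=
  Relation.ReflTransGen fun x y => ∃ i m, y = reflect i m x ∧ x.norm < (reflect i m x).norm

/-- The number of reflections taking `x` below `w`. -/
noncomputable def numReflections (w x : Alcove) : ℕ :=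
  {t : (_ : Fin 3) × ℤ | LE (reflect t.1 t.2 x) w}.ncard

theorem reflect_base_injective :
    Function.Injective fun t : (_ : Fin 3) × ℤ => reflect t.1 t.2 base := by
  rintro ⟨i, m⟩ ⟨j, n⟩ h
  simp only at h
  have ha := congrArg a h
  have hb := congrArg b h
  have hd := congrArg d h
  suffices i = j ∧ m = n by rw [this.1, this.2]
  fin_cases i <;> fin_cases j <;> simp [reflect, base] at ha hb hd ⊢ <;> omega

/-- The rotation of order three fixing the fundamental alcove. -/
def rotate (x : Alcove) : Alcove := ⟨x.b, x.d, x.a, by have := x.sum_eq; omega⟩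

theorem norm_rotate (x : Alcove) : x.rotate.norm = x.norm := by
  simp only [rotate, norm]
  omega

theorem rotate_reflect (i : Fin 3) (m : ℤ) (x : Alcove) :
    (reflect i m x).rotate = reflect (i - 1) m x.rotate := by
  fin_cases i <;> rfl

theorem LE.rotate {x y : Alcove} (h : LE x y) : LE x.rotate y.rotate := by
  refine Relation.ReflTransGen.lift Alcove.rotate ?_ _ _ h
  rintro x y ⟨i, m, rfl, hlt⟩
  refine ⟨i - 1, m, rotate_reflect i m x, ?_⟩
  rwa [← rotate_reflect, norm_rotate, norm_rotate]

theorem rotate_le_rotate {x y : Alcove} : LE x.rotate y.rotate ↔ LE x y :=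
  ⟨fun h => h.rotate.rotate, LE.rotate⟩

theorem numReflections_rotate (w x : Alcove) :
    numReflections w.rotate x.rotate = numReflections w x := by
  have h : {t : (_ : Fin 3) × ℤ | LE (reflect t.1 t.2 x.rotate) w.rotate} =
      (fun t : (_ : Fin 3) × ℤ => ⟨t.1 - 1, t.2⟩) '' {t | LE (reflect t.1 t.2 x) w} := by
    ext ⟨i, m⟩
    constructor
    · intro h
      refine ⟨⟨i + 1, m⟩, ?_, by simp⟩
      rw [Set.mem_ofPred_eq, ← rotate_le_rotate, rotate_reflect]
      simpa using h
    · rintro ⟨⟨j, n⟩, h, e⟩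
      rw [← e]
      rw [Set.mem_ofPred_eq, ← rotate_le_rotate, rotate_reflect] at h
      exact h
  rw [numReflections, h, Set.ncard_image_of_injective]
  · rfl
  · rintro ⟨i, m⟩ ⟨j, n⟩ h
    simpa using h

end Alcove

variable (cs)

theorem bruhatLE_iff {x w : W} : cs.BruhatLE x w ↔ LE (alcove cs x) (alcove cs w) := by
  constructor
  · intro h
    refine Relation.ReflTransGen.lift (alcove cs) ?_ _ _ h
    rintro u v ⟨r, hr, rfl, hlt⟩
    obtain ⟨i, m, hi⟩ := exists_action_eq_reflectPerm hr
    rw [length_eq_norm, length_eq_norm, alcove_mul, hi, reflectPerm_apply] at hlt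
    exact ⟨i, m, by rw [alcove_mul, hi, reflectPerm_apply], hlt⟩
  · intro h
    suffices ∀ y, LE (alcove cs x) y → ∃ v, alcove cs v = y ∧ cs.BruhatLE x v by
      obtain ⟨v, hv, hxv⟩ := this _ h
      rwa [alcove_injective cs hv] at hxv
    intro y hy
    induction hy with
    | refl => exact ⟨x, rfl, .refl⟩
    | tail _ hz ih =>
      obtain ⟨v, rfl, hv⟩ := ih
      obtain ⟨i, m, rfl, hlt⟩ := hz
      obtain ⟨r, hr, hi⟩ := exists_isReflection cs i m
      have e : alcove cs (r * v) = reflect i m (alcove cs v) := by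
        rw [alcove_mul, hi, reflectPerm_apply]
      refine ⟨r * v, e, hv.tail ⟨r, hr, rfl, ?_⟩⟩
      rwa [length_eq_norm, length_eq_norm, e]

theorem q_eq (w x : W) :
    cs.q w x = numReflections (alcove cs w) (alcove cs x) - (alcove cs w).norm := by
  rw [CoxeterSystem.q, length_eq_norm]
  choose f hf using exists_isReflection cs
  have h : cs.reflectionsBelow w x = (fun t : (_ : Fin 3) × ℤ => f t.1 t.2) ''
      {t | LE (reflect t.1 t.2 (alcove cs x)) (alcove cs w)} := by
    ext r
    constructor
    · rintro ⟨hr, hle⟩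
      obtain ⟨i, m, hi⟩ := exists_action_eq_reflectPerm hr
      refine ⟨⟨i, m⟩, ?_, ?_⟩
      · rwa [bruhatLE_iff, alcove_mul, hi] at hle
      · apply alcove_injective cs
        simp only [alcove]
        rw [hi, (hf i m).2]
    · rintro ⟨⟨i, m⟩, h, rfl⟩
      refine ⟨(hf i m).1, ?_⟩
      rwa [bruhatLE_iff, alcove_mul, (hf i m).2]
  rw [h, Set.ncard_image_of_injective]
  · rfl
  · rintro ⟨i, m⟩ ⟨j, n⟩ h
    apply reflect_base_injective
    have := congrArg (fun r => action cs r base) h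
    simpa [hf] using this

/-! ### Spiral elements. -/

theorem alcove_spiralWord (n : ℕ) {i j k : Fin 3} (hij : i ≠ j) (hjk : j ≠ k) (hik : i ≠ k) :
    (alcove cs (cs.wordProd (spiralWord i j k n))).coord i = -((n + 1) / 2) ∧
    (alcove cs (cs.wordProd (spiralWord i j k n))).coord j = 0 ∧
    (alcove cs (cs.wordProd (spiralWord i j k n))).coord k = n / 2 := by
  induction n generalizing i j k with
  | zero =>
    rw [spiralWord, cs.wordProd_nil, alcove_one]
    fin_cases i <;> fin_cases j <;> fin_cases k <;> simp [coord, base]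
  | succ n ih =>
    obtain ⟨h1, h2, h3⟩ := ih hjk (Ne.symm hik) (Ne.symm hij)
    rw [spiralWord, cs.wordProd_cons, alcove_simple_mul]
    fin_cases i <;> fin_cases j <;> first | exact absurd rfl hij | skip
    all_goals fin_cases k <;> first | exact absurd rfl hik | exact absurd rfl hjk | skip
    all_goals simp [coord, reflect] at h1 h2 h3 ⊢; omega

theorem isSpiral_of_coord_eq {w : W} (i j k : Fin 3) (hij : i ≠ j) (hjk : j ≠ k) (hik : i ≠ k)
    (n : ℕ) (hi : (alcove cs w).coord i = -((n + 1) / 2)) (hj : (alcove cs w).coord j = 0)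
    (hk : (alcove cs w).coord k = n / 2) : IsSpiral cs w := by
  obtain ⟨h1, h2, h3⟩ := alcove_spiralWord cs n hij hjk hik
  have e : alcove cs (cs.wordProd (spiralWord i j k n)) = alcove cs w := by
    rw [← hi] at h1
    rw [← hj] at h2
    rw [← hk] at h3
    fin_cases i <;> fin_cases j <;> first | exact absurd rfl hij | skip
    all_goals fin_cases k <;> first | exact absurd rfl hik | exact absurd rfl hjk | skip
    all_goals simp [coord] at h1 h2 h3; ext <;> assumption
  have hlen (n : ℕ) : ∀ i j k, (spiralWord i j k n).length = n := by
    induction n with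
    | zero => intros; rfl
    | succ n ih => intro i j k; simp [spiralWord, ih]
  refine ⟨i, j, k, n, hij, hjk, hik, ?_, alcove_injective cs e⟩
  rw [CoxeterSystem.IsReduced, length_eq_norm, e, hlen]
  fin_cases i <;> fin_cases j <;> first | exact absurd rfl hij | skip
  all_goals fin_cases k <;> first | exact absurd rfl hik | exact absurd rfl hjk | skip
  all_goals simp [coord, Alcove.norm] at hi hj hk ⊢; omega

theorem coord_ne_zero_of_not_isSpiral {w : W} (hw : ¬ IsSpiral cs w) :
    (alcove cs w).a ≠ 0 ∧ (alcove cs w).b ≠ 0 ∧ (alcove cs w).d ≠ 0 := by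
  have key (i j k : Fin 3) (hij : i ≠ j) (hjk : j ≠ k) (hik : i ≠ k)
      (hj : (alcove cs w).coord j = 0)
      (hs : (alcove cs w).coord i + (alcove cs w).coord k = 0 ∨
        (alcove cs w).coord i + (alcove cs w).coord k = -1) : False := by
    refine hw ?_
    -- The sign of coordinate `k` decides the sense in which the spiral turns, and the value of the
    -- sum decides the parity of its length.
    rcases le_or_gt 0 ((alcove cs w).coord k) with hk | hk
    · obtain ⟨t, ht⟩ := Int.eq_ofNat_of_zero_le hk
      rcases hs with hs | hs
      · exact isSpiral_of_coord_eq cs i j k hij hjk hik (2 * t) (by omega) hj (by omega)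
      · exact isSpiral_of_coord_eq cs i j k hij hjk hik (2 * t + 1) (by omega) hj (by omega)
    · have hi : 0 ≤ (alcove cs w).coord i := by omega
      obtain ⟨t, ht⟩ := Int.eq_ofNat_of_zero_le hi
      rcases hs with hs | hs
      · exact isSpiral_of_coord_eq cs k j i hjk.symm hij.symm hik.symm (2 * t) (by omega) hj
          (by omega)
      · exact isSpiral_of_coord_eq cs k j i hjk.symm hij.symm hik.symm (2 * t + 1) (by omega) hj
          (by omega)
  have hs := (alcove cs w).sum_eq
  refine ⟨fun h => ?_, fun h => ?_, fun h => ?_⟩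
  · refine key 1 0 2 (by decide) (by decide) (by decide) h ?_
    simp [coord]; omega
  · refine key 0 1 2 (by decide) (by decide) (by decide) h ?_
    simp [coord]; omega
  · refine key 0 2 1 (by decide) (by decide) (by decide) h ?_
    simp [coord]; omega

/-! ### Hexagons and their chords. -/

namespace Alcove

/-- A hexagon with sides orthogonal to the hyperplane directions, given by bounds for the
differences `a - d`, `b - d` and `a - b` of coordinates. -/
structure Hexagon where
  (loP hiP loQ hiQ loR hiR : ℤ)

/-- The alcoves in a hexagon. -/
def Hexagon.Contains (H : Hexagon) (x : Alcove) : Prop :=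
  (H.loP ≤ x.a - x.d ∧ x.a - x.d ≤ H.hiP) ∧ (H.loQ ≤ x.b - x.d ∧ x.b - x.d ≤ H.hiQ) ∧
    (H.loR ≤ x.a - x.b ∧ x.a - x.b ≤ H.hiR)

/-- The number of reflections orthogonal to the `i`-th direction taking `x` into the hexagon. -/
def Hexagon.count (H : Hexagon) (x : Alcove) (i : Fin 3) : ℕ :=
  (![min ((H.hiP + (x.a - x.b) + 1) / 3) ((H.hiR + (x.a - x.d) + 1) / 3) + 1 -
      max ((H.loP + (x.a - x.b) + 3) / 3) ((H.loR + (x.a - x.d) + 3) / 3),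
    min ((H.hiQ - (x.a - x.b) + 1) / 3) ((x.b - x.d + 1 - H.loR) / 3) + 1 -
      max ((H.loQ - (x.a - x.b) + 3) / 3) ((x.b - x.d - H.hiR + 3) / 3),
    min ((1 - (x.b - x.d) - H.loP) / 3) ((1 - (x.a - x.d) - H.loQ) / 3) + 1 -
      max ((3 - (x.b - x.d) - H.hiP) / 3) ((3 - (x.a - x.d) - H.hiQ) / 3)] i).toNat

/-- Reflections in families `0`, `1`, `2` preserve `b - d`, `a - d`, `a - b` respectively. One pair
of bounds thus holds automatically, and the other two confine `m` to an interval. -/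
theorem Hexagon.numReflections_eq {H : Hexagon} {w x : Alcove} (hw : ∀ y, LE y w ↔ H.Contains y)
    (hx : H.Contains x) :
    numReflections w x = H.count x 0 + H.count x 1 + H.count x 2 := by
  have h : {t : (_ : Fin 3) × ℤ | LE (reflect t.1 t.2 x) w} =
      ((Finset.univ : Finset (Fin 3)).sigma fun i => Finset.Icc
        (![max ((H.loP + (x.a - x.b) + 3) / 3) ((H.loR + (x.a - x.d) + 3) / 3),
          max ((H.loQ - (x.a - x.b) + 3) / 3) ((x.b - x.d - H.hiR + 3) / 3),
          max ((3 - (x.b - x.d) - H.hiP) / 3) ((3 - (x.a - x.d) - H.hiQ) / 3)] i)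
        (![min ((H.hiP + (x.a - x.b) + 1) / 3) ((H.hiR + (x.a - x.d) + 1) / 3),
          min ((H.hiQ - (x.a - x.b) + 1) / 3) ((x.b - x.d + 1 - H.loR) / 3),
          min ((1 - (x.b - x.d) - H.loP) / 3) ((1 - (x.a - x.d) - H.loQ) / 3)] i) :
        Finset ((_ : Fin 3) × ℤ)) := by
    obtain ⟨hP, hQ, hR⟩ := hx
    ext ⟨i, m⟩
    rw [Set.mem_ofPred_eq, hw]
    fin_cases i <;> simp [reflect, Contains] <;> omega
  rw [numReflections, h, Set.ncard_coe_finset, Finset.card_sigma, Fin.sum_univ_three]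
  simp [Hexagon.count]

/-! ### The hexagons of alcoves below a given one -/

/-- The hexagon of the alcoves below an alcove `w` with `w.a, w.b < 0`. -/
def negHexagon (w : Alcove) : Hexagon where
  loP := w.a - w.d
  hiP := w.d - w.b - 2
  loQ := w.b - w.d
  hiQ := w.d - w.a - 2
  loR := w.b - w.d + 1
  hiR := w.d - w.a - 1

/-- The hexagon of the alcoves below an alcove `w` with `w.a, w.b > 0`. -/
def posHexagon (w : Alcove) : Hexagon where
  loP := w.d - w.b + 1
  hiP := w.a - w.d
  loQ := w.d - w.a + 1
  hiQ := w.b - w.d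
  loR := w.d - w.a + 2
  hiR := w.b - w.d - 2

/-- `down` makes the hexagon a lower set containing `w`. By `up`, any other alcove in it can climb
without leaving it, and since the norm is bounded there, the climb ends at `w`. -/
theorem le_iff_of_exists {H : Hexagon} {w : Alcove} (hw : H.Contains w)
    (down : ∀ x i m, x.norm < (reflect i m x).norm → H.Contains (reflect i m x) → H.Contains x)
    (up : ∀ x, H.Contains x → x ≠ w →
      ∃ i m, x.norm < (reflect i m x).norm ∧ H.Contains (reflect i m x)) (x : Alcove) :
    LE x w ↔ H.Contains x := by
  constructor
  · intro h
    induction h using Relation.ReflTransGen.head_induction_on with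
    | refl => exact hw
    | head h _ ih =>
      obtain ⟨i, m, rfl, hlt⟩ := h
      exact down _ i m hlt ih
  · have bounded (x : Alcove) (hx : H.Contains x) :
        x.norm ≤ 4 * (H.hiP.natAbs + H.loP.natAbs + H.hiQ.natAbs + H.loQ.natAbs + 1) := by
      obtain ⟨hP, hQ, hR⟩ := hx
      have := x.sum_eq
      simp only [norm]
      omega
    intro hx
    induction hn : 4 * (H.hiP.natAbs + H.loP.natAbs + H.hiQ.natAbs + H.loQ.natAbs + 1) - x.norm
      using Nat.strong_induction_on generalizing x with
    | _ n ih =>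
      subst hn
      by_cases h : x = w
      · rw [h]; exact .refl
      · obtain ⟨i, m, hlt, hc⟩ := up x hx h
        have := bounded _ hc
        exact .head ⟨i, m, rfl, hlt⟩ (ih _ (by omega) _ hc rfl)

theorem negHexagon_down {w : Alcove} (x : Alcove) (i : Fin 3) (m : ℤ)
    (hlt : x.norm < (reflect i m x).norm) (h : (negHexagon w).Contains (reflect i m x)) :
    (negHexagon w).Contains x := by
  have := w.sum_eq
  have := x.sum_eq
  rw [norm_lt_norm_reflect_iff] at hlt
  simp only [negHexagon, Hexagon.Contains] at h ⊢
  fin_cases i <;> simp [reflect, coord] at hlt h ⊢ <;> omega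

theorem posHexagon_down {w : Alcove} (x : Alcove) (i : Fin 3) (m : ℤ)
    (hlt : x.norm < (reflect i m x).norm) (h : (posHexagon w).Contains (reflect i m x)) :
    (posHexagon w).Contains x := by
  have := w.sum_eq
  have := x.sum_eq
  rw [norm_lt_norm_reflect_iff] at hlt
  simp only [posHexagon, Hexagon.Contains] at h ⊢
  fin_cases i <;> simp [reflect, coord] at hlt h ⊢ <;> omega

/-! ### Chord lengths as functions of position. -/

/-- The sign of `t` decides which bounds are active; the residue condition `hs` lets their two
floors merge into one. -/
theorem toNat_chord {c c' α α' t S : ℤ} (hc : c' = c + t) (hα : α' = α + t) (hS : S = c - α + 4)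
    (hs : (c + α + t) % 3 = 0 ∨ (c + α + t) % 3 = 1)
    (h : |t| ≤ S) :
    ((min (c / 3) (c' / 3) + 1 - max (α / 3) (α' / 3)).toNat : ℤ) = (S - |t|) / 3 := by
  subst hc hα hS
  obtain ⟨k, hk⟩ : ∃ k, c + α + t = 3 * k ∨ c + α + t = 3 * k + 1 := ⟨(c + α + t) / 3, by omega⟩
  clear hs
  rcases abs_cases t with ⟨e, ht⟩ | ⟨e, ht⟩
  · rw [e] at h ⊢
    obtain ⟨i, hi⟩ : ∃ i, c = 3 * i ∨ c = 3 * i + 1 ∨ c = 3 * i + 2 := ⟨c / 3, by omega⟩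
    rw [min_eq_left (by omega), max_eq_right (by omega)]
    rcases hk with hk | hk <;> rcases hi with hi | hi | hi <;> omega
  · rw [e] at h ⊢
    obtain ⟨i, hi⟩ : ∃ i, α = 3 * i ∨ α = 3 * i + 1 ∨ α = 3 * i + 2 := ⟨α / 3, by omega⟩
    rw [min_eq_right (by omega), max_eq_left (by omega)]
    rcases hk with hk | hk <;> rcases hi with hi | hi | hi <;> omega

/-- The number of alcoves of a given orientation on a chord of the hexagon `posHexagon w`, away from
the centre. -/
def shiftedChord (S t : ℤ) : ℤ := (S - 1 - max 1 (max (t - 1) (-t))) / 3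

/-- The correction to `shiftedChord` near the centre of the hexagon. -/
def chordDefect (t e : ℤ) : ℤ := if t = 0 ∧ e = 1 ∨ t = 1 ∧ e = 0 then 1 else 0

/-- Used for families `0` and `1` in `posHexagon`. The offsets `-2` and `+1` cut off the tip of the
tent, leaving a plateau for `-1 ≤ t ≤ 2`; in its middle the rounding also depends on the orientation
`e` of the alcove. -/
theorem toNat_chord_of_shift {c c' α α' t S e e' : ℤ} (hc : c' = c + t - 2)
    (hα : α' = α + t + 1) (hS : S = c - α + 3) (he : e = 0 ∨ e = 1) (he' : e' = 0 ∨ e' = 1)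
    (hs : (c + α + t + 1) % 3 = e) (hd : (α - c) % 3 = e')
    (h : max 1 (max (t - 1) (-t)) ≤ S - 1) (h3 : 5 ≤ S) :
    ((min (c / 3) (c' / 3) + 1 - max (α / 3) (α' / 3)).toNat : ℤ) =
      shiftedChord S t - if e' = 1 then chordDefect t e else 0 := by
  unfold shiftedChord chordDefect
  rw [← ite_and]
  subst hc hα hS
  obtain ⟨k, hk⟩ : ∃ k, c + α + t + 1 = 3 * k + e := ⟨(c + α + t + 1) / 3, by omega⟩
  obtain ⟨i, hi⟩ : ∃ i, α - c = 3 * i + e' := ⟨(α - c) / 3, by omega⟩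
  clear hs hd
  obtain ⟨j, hj⟩ : ∃ j, α = 3 * j ∨ α = 3 * j + 1 ∨ α = 3 * j + 2 := ⟨α / 3, by omega⟩
  rcases lt_or_ge t 0 with ht | ht
  · have hm : max 1 (max (t - 1) (-t)) = -t := by omega
    rw [hm] at h ⊢
    rw [min_eq_right (by omega), max_eq_left (by omega), if_neg (by omega)]
    rcases he with rfl | rfl <;> rcases he' with rfl | rfl <;> rcases hj with hj | hj | hj <;> omega
  rcases lt_or_ge 1 t with ht' | ht'
  · have hm : max 1 (max (t - 1) (-t)) = t - 1 := by omega
    rw [hm] at h ⊢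
    rw [min_eq_left (by omega), max_eq_right (by omega), if_neg (by omega)]
    rcases he with rfl | rfl <;> rcases he' with rfl | rfl <;> rcases hj with hj | hj | hj <;> omega
  have hm : max 1 (max (t - 1) (-t)) = 1 := by omega
  rw [hm] at h ⊢
  rw [min_eq_right (by omega), max_eq_right (by omega)]
  obtain rfl | rfl : t = 0 ∨ t = 1 := by omega
  · rcases he with rfl | rfl <;> rcases he' with rfl | rfl <;> simp <;>
      rcases hj with hj | hj | hj <;> omega
  · rcases he with rfl | rfl <;> rcases he' with rfl | rfl <;> simp <;>
      rcases hj with hj | hj | hj <;> omega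

theorem negHexagon_count {w x : Alcove}
    (hx : (negHexagon w).Contains x) :
    ((negHexagon w).count x 0 : ℤ) =
      (2 * w.d - w.a - w.b - |x.b - x.d + w.b - w.a + 1|) / 3 ∧
    ((negHexagon w).count x 1 : ℤ) =
      (2 * w.d - w.a - w.b - |x.a - x.d + w.a - w.b + 1|) / 3 ∧
    ((negHexagon w).count x 2 : ℤ) =
      (2 * w.d - w.a - w.b - |x.a - x.b + w.b - w.a|) / 3 := by
  have hxs := x.sum_eq
  have hws := w.sum_eq
  obtain ⟨hP, hQ, hR⟩ := hx
  simp only [negHexagon] at hP hQ hR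
  simp only [negHexagon, Hexagon.count, Matrix.cons_val]
  refine ⟨toNat_chord (by ring) (by ring) (by ring) (by omega) (abs_le.2 (by omega)),
    toNat_chord (by ring) (by ring) (by ring) (by omega) (abs_le.2 (by omega)), ?_⟩
  rw [min_comm, max_comm]
  exact toNat_chord (by ring) (by ring) (by ring) (by omega) (abs_le.2 (by omega))

/-- The number of reflections taking an alcove into the hexagon `posHexagon w`, in terms of the
positions `A`, `B`, `C` of the three chords through the alcove. -/
def chordSum (S ε A B C e : ℤ) : ℤ :=
  shiftedChord S A - (if ε = 1 then chordDefect A e else 0) +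
    (shiftedChord S B - if ε = 1 then chordDefect B e else 0) + (S + 1 - |C|) / 3

theorem posHexagon_count {w x : Alcove} (hx : (posHexagon w).Contains x) :
    ((posHexagon w).count x 0 : ℤ) + (posHexagon w).count x 1 + (posHexagon w).count x 2 =
      chordSum (w.a + w.b - 2 * w.d) (-(w.a + w.b + w.d)) (x.b - x.d + w.b - w.a)
        (x.a - x.d + w.a - w.b) (x.a - x.b + w.b - w.a) (-(x.a + x.b + x.d)) := by
  have hxs := x.sum_eq
  have hws := w.sum_eq
  obtain ⟨hP, hQ, hR⟩ := hx
  simp only [posHexagon] at hP hQ hR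
  simp only [posHexagon, Hexagon.count, Matrix.cons_val]
  -- The bound `5 ≤ S` needs no sign condition on `w`: `loR ≤ hiR` gives `4 ≤ S`, and `S` is not `1`
  -- modulo `3`.
  refine congrArg₂ _ (congrArg₂ _
    (toNat_chord_of_shift (by ring) (by ring) (by ring) (by omega) (by omega) (by omega)
      (by omega) (by omega) (by omega))
    (toNat_chord_of_shift (by ring) (by ring) (by ring) (by omega) (by omega) (by omega)
      (by omega) (by omega) (by omega))) ?_
  rw [min_comm, max_comm]
  exact toNat_chord (by ring) (by ring) (by ring) (by omega) (abs_le.2 (by omega))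

/-! ### The alcoves below `w` fill the hexagon. -/

theorem negHexagon_up {w : Alcove} (ha : w.a < 0) (hb : w.b < 0) (x : Alcove)
    (hx : (negHexagon w).Contains x) (hne : x ≠ w) :
    ∃ i m, x.norm < (reflect i m x).norm ∧ (negHexagon w).Contains (reflect i m x) := by
  by_contra! hc
  simp only [norm_lt_norm_reflect_iff] at hc
  -- A few mirrors suffice: hyperplanes at levels `0` and `1`, bounding strips around the
  -- fundamental alcove, and in each family the hyperplane nearest to `w` that separates it from
  -- that alcove.
  have h1 := hc 0 0
  have h2 := hc 0 1
  have h3 := hc 0 (w.a + 1)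
  have h4 := hc 1 0
  have h5 := hc 1 1
  have h6 := hc 1 (w.b + 1)
  have h7 := hc 2 w.d
  clear hc
  have hxs := x.sum_eq
  have hws := w.sum_eq
  have hne' : ¬ (x.a = w.a ∧ x.b = w.b ∧ x.d = w.d) := fun h => hne (by ext <;> simp [h])
  simp [reflect, coord, negHexagon, Hexagon.Contains] at hx h1 h2 h3 h4 h5 h6 h7
  omega

theorem posHexagon_up {w : Alcove} (ha : 0 < w.a) (hb : 0 < w.b) (x : Alcove)
    (hx : (posHexagon w).Contains x) (hne : x ≠ w) :
    ∃ i m, x.norm < (reflect i m x).norm ∧ (posHexagon w).Contains (reflect i m x) := by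
  by_contra! hc
  simp only [norm_lt_norm_reflect_iff] at hc
  have h1 := hc 0 0
  have h2 := hc 0 1
  have h3 := hc 0 w.a
  have h4 := hc 1 0
  have h5 := hc 1 1
  have h6 := hc 1 w.b
  have h7 := hc 2 0
  have h8 := hc 2 (w.d + 1)
  clear hc
  have hxs := x.sum_eq
  have hws := w.sum_eq
  have hne' : ¬ (x.a = w.a ∧ x.b = w.b ∧ x.d = w.d) := fun h => hne (by ext <;> simp [h])
  simp [reflect, coord, posHexagon, Hexagon.Contains] at hx h1 h2 h3 h4 h5 h6 h7 h8
  omega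

theorem le_iff_negHexagon {w : Alcove} (ha : w.a < 0) (hb : w.b < 0) (x : Alcove) :
    LE x w ↔ (negHexagon w).Contains x := by
  refine le_iff_of_exists ?_ negHexagon_down (negHexagon_up ha hb) x
  have := w.sum_eq
  simp only [negHexagon, Hexagon.Contains]
  omega

theorem le_iff_posHexagon {w : Alcove} (ha : 0 < w.a) (hb : 0 < w.b) (x : Alcove) :
    LE x w ↔ (posHexagon w).Contains x := by
  refine le_iff_of_exists ?_ posHexagon_down (posHexagon_up ha hb) x
  have := w.sum_eq
  simp only [posHexagon, Hexagon.Contains]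
  omega

/-! ### Monotonicity of the count for negative `a` and `b`. -/

/-- Up to rounding: `|B| + |C| = max |B + C| |B - C|`. The reflection keeps `B - C` and sends `B +
C` to `6 * m - (B + C)`, which under `h` is no smaller in absolute value. -/
theorem chord_add_chord_le {S B C m : ℤ} (h : m ≤ 0 ∧ 3 * m ≤ B + C ∨ 0 ≤ m ∧ B + C ≤ 3 * m) :
    (S - |3 * m - C|) / 3 + (S - |3 * m - B|) / 3 ≤ (S - |B|) / 3 + (S - |C|) / 3 := by
  rcases abs_cases (3 * m - C) with ⟨e, _⟩ | ⟨e, _⟩ <;> rw [e] <;> clear e <;>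
  rcases abs_cases (3 * m - B) with ⟨e, _⟩ | ⟨e, _⟩ <;> rw [e] <;> clear e <;>
  rcases abs_cases B with ⟨e, _⟩ | ⟨e, _⟩ <;> rw [e] <;> clear e <;>
  rcases abs_cases C with ⟨e, _⟩ | ⟨e, _⟩ <;> rw [e] <;> clear e <;> omega

theorem numReflections_le_of_neg {w x : Alcove} (ha : w.a < 0) (hb : w.b < 0) {i : Fin 3} {m : ℤ}
    (hlt : x.norm < (reflect i m x).norm) (hw : LE (reflect i m x) w) :
    numReflections w (reflect i m x) ≤ numReflections w x := by
  have hy := (le_iff_negHexagon ha hb _).1 hw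
  have hx := negHexagon_down x i m hlt hy
  rw [Hexagon.numReflections_eq (le_iff_negHexagon ha hb) hx,
    Hexagon.numReflections_eq (le_iff_negHexagon ha hb) hy]
  obtain ⟨h0, h1, h2⟩ := negHexagon_count hx
  obtain ⟨k0, k1, k2⟩ := negHexagon_count hy
  zify
  rw [h0, h1, h2, k0, k1, k2]
  have := x.sum_eq
  rw [norm_lt_norm_reflect_iff] at hlt
  clear hx hy hw h0 h1 h2 k0 k1 k2
  fin_cases i <;> simp only [reflect, coord, Fin.zero_eta, Fin.mk_one, Fin.reduceFinMk,
    Matrix.cons_val] at hlt ⊢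
  · have h := chord_add_chord_le (S := 2 * w.d - w.a - w.b) (m := m)
      (B := x.a - x.d + w.a - w.b + 1) (C := x.a - x.b + w.b - w.a) (by omega)
    ring_nf at h ⊢
    linarith
  · have h := chord_add_chord_le (S := 2 * w.d - w.a - w.b) (m := m)
      (B := x.b - x.d + w.b - w.a + 1) (C := -(x.a - x.b + w.b - w.a)) (by omega)
    rw [abs_neg, abs_sub_comm (3 * m) (_ + 1)] at h
    ring_nf at h ⊢
    linarith
  · have h := chord_add_chord_le (S := 2 * w.d - w.a - w.b) (m := 1 - m)
      (B := x.a - x.d + w.a - w.b + 1) (C := x.b - x.d + w.b - w.a + 1) (by omega)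
    ring_nf at h ⊢
    linarith

/-! ### Chord inequalities for positive `a` and `b`. -/

/-- Linear upper bounds suffice for the reflected alcove; only the chords of the original one need
the exact values of `shiftedChord_cases` and `chord_cases`. -/
theorem shiftedChord_le (S t : ℤ) :
    3 * shiftedChord S t ≤ S - 2 ∧ 3 * shiftedChord S t ≤ S - t ∧
      3 * shiftedChord S t ≤ S - 1 + t := by
  unfold shiftedChord
  omega

theorem shiftedChord_cases (S t : ℤ) :
    shiftedChord S t = (S - 2) / 3 ∧ -1 ≤ t ∧ t ≤ 2 ∨ shiftedChord S t = (S - t) / 3 ∧ 2 < t ∨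
      shiftedChord S t = (S - 1 + t) / 3 ∧ t < -1 := by
  unfold shiftedChord
  omega

theorem chord_le (S t : ℤ) :
    3 * ((S + 1 - |t|) / 3) ≤ S + 1 - t ∧ 3 * ((S + 1 - |t|) / 3) ≤ S + 1 + t := by
  have := le_abs_self t
  have := neg_abs_le t
  omega

theorem chord_cases (S t : ℤ) :
    (S + 1 - |t|) / 3 = (S + 1 - t) / 3 ∧ 0 ≤ t ∨ (S + 1 - |t|) / 3 = (S + 1 + t) / 3 ∧ t < 0 := by
  rcases abs_cases t with ⟨e, h⟩ | ⟨e, h⟩ <;> rw [e] <;> simp [h]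

theorem shiftedChord_add_chord_le {S B C m a e : ℤ} (hs : S % 3 ≠ 1) (he : e = 0 ∨ e = 1)
    (h : B + C = 3 * a + e) (hm : m ≤ 0 ∧ m ≤ a ∨ 0 < m ∧ a < m) :
    shiftedChord S (3 * m - 1 - C) + (S + 1 - |3 * m - 1 - B|) / 3 ≤
      shiftedChord S B + (S + 1 - |C|) / 3 := by
  obtain ⟨k, hk⟩ : ∃ k, B = 3 * k ∨ B = 3 * k + 1 ∨ B = 3 * k + 2 := ⟨B / 3, by omega⟩
  obtain ⟨s, hs⟩ : ∃ s, S = 3 * s ∨ S = 3 * s + 2 := ⟨S / 3, by omega⟩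
  have h1 := shiftedChord_le S (3 * m - 1 - C)
  have h2 := chord_le S (3 * m - 1 - B)
  have h3 := shiftedChord_cases S B
  have h4 := chord_cases S C
  generalize shiftedChord S (3 * m - 1 - C) = f at *
  generalize (S + 1 - |3 * m - 1 - B|) / 3 = g at *
  generalize shiftedChord S B = f' at *
  generalize (S + 1 - |C|) / 3 = g' at *
  rcases he with rfl | rfl <;> rcases hk with rfl | rfl | rfl <;> rcases hs with rfl | rfl <;> omega

theorem shiftedChord_add_shiftedChord_le {S A B m a e : ℤ} (hs : S % 3 ≠ 1) (he : e = 0 ∨ e = 1)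
    (h : A + B = 3 * a - e) (hm : m ≤ 0 ∧ m ≤ -a ∨ 0 < m ∧ -a < m) :
    shiftedChord S (1 - 3 * m - B) + shiftedChord S (1 - 3 * m - A) ≤
      shiftedChord S A + shiftedChord S B := by
  obtain ⟨k, hk⟩ : ∃ k, B = 3 * k ∨ B = 3 * k + 1 ∨ B = 3 * k + 2 := ⟨B / 3, by omega⟩
  obtain ⟨s, hs⟩ : ∃ s, S = 3 * s ∨ S = 3 * s + 2 := ⟨S / 3, by omega⟩
  have h1 := shiftedChord_le S (1 - 3 * m - B)
  have h2 := shiftedChord_le S (1 - 3 * m - A)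
  have h3 := shiftedChord_cases S A
  have h4 := shiftedChord_cases S B
  generalize shiftedChord S (1 - 3 * m - B) = f at *
  generalize shiftedChord S (1 - 3 * m - A) = g at *
  generalize shiftedChord S A = f' at *
  generalize shiftedChord S B = g' at *
  rcases he with rfl | rfl <;> rcases hk with rfl | rfl | rfl <;> rcases hs with rfl | rfl <;> omega

theorem chordDefect_nonneg (t e : ℤ) : 0 ≤ chordDefect t e := by
  unfold chordDefect
  split_ifs <;> decide

/-- The fixed chord `A` has a defect at `x`, which the change of orientation removes at the image.
If the count at the image exceeds the length by only one, the other two chords must gain one on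
descent to compensate. -/
theorem lt_of_chordDefect_left {a' b' e A B C a d m : ℤ}
    (hA : A = 0 ∧ e = 1 ∨ A = 1 ∧ e = 0) (hC : C = B - A - 3 * (a' - b'))
    (hd : A + B = -(3 * d) - e) (ha : B + C = 3 * a + e)
    (hm : m ≤ 0 ∧ m ≤ a ∨ 0 < m ∧ a < m)
    (h : 2 * (a' + b') + 1 < shiftedChord (3 * (a' + b') + 2) A +
      shiftedChord (3 * (a' + b') + 2) (3 * m - 1 - C) +
      (3 * (a' + b') + 2 + 1 - |3 * m - 1 - B|) / 3) :
    2 * (a' + b') + 1 < shiftedChord (3 * (a' + b') + 2) A - 1 +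
      shiftedChord (3 * (a' + b') + 2) B + (3 * (a' + b') + 2 + 1 - |C|) / 3 := by
  have h1 := shiftedChord_le (3 * (a' + b') + 2) (3 * m - 1 - C)
  have h2 := chord_le (3 * (a' + b') + 2) (3 * m - 1 - B)
  have h3 := shiftedChord_cases (3 * (a' + b') + 2) A
  have h4 := shiftedChord_cases (3 * (a' + b') + 2) B
  have h5 := chord_cases (3 * (a' + b') + 2) C
  generalize shiftedChord (3 * (a' + b') + 2) (3 * m - 1 - C) = f at *
  generalize (3 * (a' + b') + 2 + 1 - |3 * m - 1 - B|) / 3 = g at *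
  generalize shiftedChord (3 * (a' + b') + 2) A = f' at *
  generalize shiftedChord (3 * (a' + b') + 2) B = f'' at *
  generalize (3 * (a' + b') + 2 + 1 - |C|) / 3 = g' at *
  rcases hA with ⟨rfl, rfl⟩ | ⟨rfl, rfl⟩ <;> omega

/-- Here the defective chord `A` is one of the two exchanged, so the image may have a defect too,
and that term must be kept in `h`. -/
theorem lt_of_chordDefect_right {a' b' e A B C b d m : ℤ}
    (hA : A = 0 ∧ e = 1 ∨ A = 1 ∧ e = 0) (hC : C = B - A - 3 * (a' - b'))
    (hd : A + B = -(3 * d) - e) (hb : A - C = 3 * b + e)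
    (hm : m ≤ 0 ∧ m ≤ b ∨ 0 < m ∧ b < m)
    (h : 2 * (a' + b') + 1 < shiftedChord (3 * (a' + b') + 2) (3 * m - 1 + C) -
      chordDefect (3 * m - 1 + C) (1 - e) + shiftedChord (3 * (a' + b') + 2) B +
      (3 * (a' + b') + 2 + 1 - |A + 1 - 3 * m|) / 3) :
    2 * (a' + b') + 1 < shiftedChord (3 * (a' + b') + 2) A - 1 +
      shiftedChord (3 * (a' + b') + 2) B + (3 * (a' + b') + 2 + 1 - |C|) / 3 := by
  have h1 := shiftedChord_le (3 * (a' + b') + 2) (3 * m - 1 + C)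
  have h2 := chord_le (3 * (a' + b') + 2) (A + 1 - 3 * m)
  have h3 := shiftedChord_cases (3 * (a' + b') + 2) A
  have h4 := shiftedChord_cases (3 * (a' + b') + 2) B
  have h5 := chord_cases (3 * (a' + b') + 2) C
  generalize shiftedChord (3 * (a' + b') + 2) (3 * m - 1 + C) = f at *
  generalize (3 * (a' + b') + 2 + 1 - |A + 1 - 3 * m|) / 3 = g at *
  generalize shiftedChord (3 * (a' + b') + 2) A = f' at *
  generalize shiftedChord (3 * (a' + b') + 2) B = f'' at *
  generalize (3 * (a' + b') + 2 + 1 - |C|) / 3 = g' at *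
  unfold chordDefect at h
  rcases hA with ⟨rfl, rfl⟩ | ⟨rfl, rfl⟩ <;> omega

theorem lt_of_chordDefect_long {a' b' e A B C d m : ℤ}
    (hA : A = 0 ∧ e = 1 ∨ A = 1 ∧ e = 0) (hC : C = B - A - 3 * (a' - b'))
    (hd : A + B = -(3 * d) - e)
    (hm : m ≤ 0 ∧ m ≤ d ∨ 0 < m ∧ d < m)
    (h : 2 * (a' + b') + 1 < shiftedChord (3 * (a' + b') + 2) (1 - 3 * m - B) -
      chordDefect (1 - 3 * m - B) (1 - e) + (shiftedChord (3 * (a' + b') + 2) (1 - 3 * m - A) -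
      chordDefect (1 - 3 * m - A) (1 - e)) + (3 * (a' + b') + 2 + 1 - |C|) / 3) :
    2 * (a' + b') + 1 < shiftedChord (3 * (a' + b') + 2) A - 1 +
      shiftedChord (3 * (a' + b') + 2) B + (3 * (a' + b') + 2 + 1 - |C|) / 3 := by
  have h1 := shiftedChord_le (3 * (a' + b') + 2) (1 - 3 * m - B)
  have h2 := shiftedChord_le (3 * (a' + b') + 2) (1 - 3 * m - A)
  have h3 := shiftedChord_cases (3 * (a' + b') + 2) A
  have h4 := shiftedChord_cases (3 * (a' + b') + 2) B
  have h5 := chord_cases (3 * (a' + b') + 2) C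
  generalize shiftedChord (3 * (a' + b') + 2) (1 - 3 * m - B) = f at *
  generalize shiftedChord (3 * (a' + b') + 2) (1 - 3 * m - A) = g at *
  generalize shiftedChord (3 * (a' + b') + 2) A = f' at *
  generalize shiftedChord (3 * (a' + b') + 2) B = f'' at *
  generalize (3 * (a' + b') + 2 + 1 - |C|) / 3 = g' at *
  have h6 := chordDefect_nonneg (1 - 3 * m - B) (1 - e)
  have h7 := chordDefect_nonneg (1 - 3 * m - A) (1 - e)
  -- Reflecting at level `0` turns the defective position into the other defective one, so the loss
  -- is the same on both sides.
  have h8 : m = 0 → chordDefect (1 - 3 * m - A) (1 - e) = 1 := by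
    intro hm
    rw [chordDefect, if_pos]
    omega
  generalize chordDefect (1 - 3 * m - B) (1 - e) = x at *
  generalize chordDefect (1 - 3 * m - A) (1 - e) = y at *
  rcases hA with ⟨rfl, rfl⟩ | ⟨rfl, rfl⟩ <;>
    rcases hm with hm | hm <;> rcases h4 with h4 | h4 | h4 <;> omega

theorem chordDefect_of_pos {t e : ℤ} (h : t = 0 ∧ e = 1 ∨ t = 1 ∧ e = 0) : chordDefect t e = 1 :=
  if_pos h

theorem chordDefect_of_neg {t e : ℤ} (h : ¬ (t = 0 ∧ e = 1 ∨ t = 1 ∧ e = 0)) :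
    chordDefect t e = 0 :=
  if_neg h

theorem chordSum_comm (S ε A B C e : ℤ) : chordSum S ε A B C e = chordSum S ε B A (-C) e := by
  rw [chordSum, chordSum, abs_neg]
  ring

/-- For `ε = 0`, or without a defect at `x`, monotonicity of the undefective sum is enough.
Otherwise exactly one of `A`, `B` is defective, since the congruence `hd` excludes both. -/
theorem lt_chordSum_of_short {a' b' d' ε e A B C a d m : ℤ} (hε : ε = 0 ∨ ε = 1)
    (he : e = 0 ∨ e = 1) (hw : a' + b' + d' = -ε) (hC : C = B - A - 3 * (a' - b'))
    (hd : A + B = -(3 * d) - e) (ha : B + C = 3 * a + e) (hm : m ≤ 0 ∧ m ≤ a ∨ 0 < m ∧ a < m)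
    (h : a' + b' - d' < chordSum (a' + b' - 2 * d') ε A (3 * m - 1 - C) (3 * m - 1 - B) (1 - e)) :
    a' + b' - d' < chordSum (a' + b' - 2 * d') ε A B C e := by
  have mono := shiftedChord_add_chord_le (S := a' + b' - 2 * d') (by omega) he ha hm
  rcases hε with rfl | rfl
  · simp only [chordSum, zero_ne_one, if_false] at h ⊢
    omega
  · obtain rfl : d' = -(a' + b') - 1 := by omega
    have hS : a' + b' - 2 * (-(a' + b') - 1) = 3 * (a' + b') + 2 := by ring
    have hN : a' + b' - (-(a' + b') - 1) = 2 * (a' + b') + 1 := by ring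
    rw [hS] at mono
    simp only [chordSum, if_true] at h ⊢
    rw [hS, hN] at h ⊢
    have n1 := chordDefect_nonneg A (1 - e)
    have n2 := chordDefect_nonneg (3 * m - 1 - C) (1 - e)
    by_cases hA : A = 0 ∧ e = 1 ∨ A = 1 ∧ e = 0
    · have := lt_of_chordDefect_left hA hC hd ha hm (by omega)
      rw [chordDefect_of_pos hA, chordDefect_of_neg (t := B) (by omega)]
      omega
    by_cases hB : B = 0 ∧ e = 1 ∨ B = 1 ∧ e = 0
    -- The symmetry exchanging the first two coordinates swaps `A` with `B` and negates `C`.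
    · have := lt_of_chordDefect_right (a' := b') (b' := a') (A := B) (B := A) (C := -C) (b := a)
        (d := d) (m := m) hB (by omega) (by omega) (by omega) hm (by
          rw [abs_sub_comm (3 * m - 1) B] at h
          rw [add_comm b' a', ← sub_eq_add_neg, show B + 1 - 3 * m = B - (3 * m - 1) by ring]
          omega)
      rw [abs_neg, add_comm b' a'] at this
      rw [chordDefect_of_pos hB, chordDefect_of_neg hA]
      omega
    · rw [chordDefect_of_neg hA, chordDefect_of_neg hB]
      omega

theorem lt_chordSum_of_long {a' b' d' ε e A B C d m : ℤ} (hε : ε = 0 ∨ ε = 1)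
    (he : e = 0 ∨ e = 1) (hw : a' + b' + d' = -ε) (hC : C = B - A - 3 * (a' - b'))
    (hd : A + B = -(3 * d) - e) (hm : m ≤ 0 ∧ m ≤ d ∨ 0 < m ∧ d < m)
    (h : a' + b' - d' <
      chordSum (a' + b' - 2 * d') ε (1 - 3 * m - B) (1 - 3 * m - A) C (1 - e)) :
    a' + b' - d' < chordSum (a' + b' - 2 * d') ε A B C e := by
  have mono := shiftedChord_add_shiftedChord_le (S := a' + b' - 2 * d') (a := -d) (by omega) he
    (by rw [hd]; ring) (by rwa [neg_neg])
  rcases hε with rfl | rfl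
  · simp only [chordSum, zero_ne_one, if_false] at h ⊢
    omega
  · obtain rfl : d' = -(a' + b') - 1 := by omega
    have hS : a' + b' - 2 * (-(a' + b') - 1) = 3 * (a' + b') + 2 := by ring
    have hN : a' + b' - (-(a' + b') - 1) = 2 * (a' + b') + 1 := by ring
    rw [hS] at mono
    simp only [chordSum, if_true] at h ⊢
    rw [hS, hN] at h ⊢
    have n1 := chordDefect_nonneg (1 - 3 * m - B) (1 - e)
    have n2 := chordDefect_nonneg (1 - 3 * m - A) (1 - e)
    by_cases hA : A = 0 ∧ e = 1 ∨ A = 1 ∧ e = 0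
    · have := lt_of_chordDefect_long hA hC hd hm (by omega)
      rw [chordDefect_of_pos hA, chordDefect_of_neg (t := B) (by omega)]
      omega
    by_cases hB : B = 0 ∧ e = 1 ∨ B = 1 ∧ e = 0
    · have := lt_of_chordDefect_long (a' := b') (b' := a') (A := B) (B := A) (C := -C)
        (d := d) (m := m) hB (by omega) (by omega) hm (by
          rw [abs_neg, add_comm b' a']
          omega)
      rw [abs_neg, add_comm b' a'] at this
      rw [chordDefect_of_pos hB, chordDefect_of_neg hA]
      omega
    · rw [chordDefect_of_neg hA, chordDefect_of_neg hB]
      omega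

/-! ### Positivity descends along one reflection. -/

theorem norm_lt_numReflections_of_pos {w x : Alcove} (ha : 0 < w.a) (hb : 0 < w.b) {i : Fin 3}
    {m : ℤ} (hlt : x.norm < (reflect i m x).norm) (hw : LE (reflect i m x) w)
    (h : w.norm < numReflections w (reflect i m x)) : w.norm < numReflections w x := by
  have hy := (le_iff_posHexagon ha hb _).1 hw
  have hx := posHexagon_down x i m hlt hy
  have hxs := x.sum_eq
  have hws := w.sum_eq
  have hn : (w.norm : ℤ) = w.a + w.b - w.d := by
    simp only [norm]
    omega
  rw [Hexagon.numReflections_eq (le_iff_posHexagon ha hb) hy] at h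
  rw [Hexagon.numReflections_eq (le_iff_posHexagon ha hb) hx]
  zify at h ⊢
  rw [posHexagon_count hy, hn] at h
  rw [posHexagon_count hx, hn]
  rw [norm_lt_norm_reflect_iff] at hlt
  clear hx hy hw
  fin_cases i <;> simp only [reflect, coord, Fin.zero_eta, Fin.mk_one, Fin.reduceFinMk,
    Matrix.cons_val] at hlt h
  · refine lt_chordSum_of_short (a := x.a) (d := x.d) (m := m) (by omega) (by omega) (by ring)
      (by ring) (by ring) (by ring) hlt ?_
    convert h using 2 <;> ring
  · rw [chordSum_comm] at h ⊢
    have := lt_chordSum_of_short (a' := w.b) (b' := w.a) (d' := w.d) (ε := -(w.a + w.b + w.d))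
      (e := -(x.a + x.b + x.d)) (A := x.a - x.d + w.a - w.b) (B := x.b - x.d + w.b - w.a)
      (C := -(x.a - x.b + w.b - w.a)) (a := x.b) (d := x.d) (m := m)
      (by omega) (by omega) (by ring) (by ring) (by ring) (by ring) hlt
    rw [add_comm w.b w.a] at this
    refine this ?_
    convert h using 2 <;> ring
  · refine lt_chordSum_of_long (d := x.d) (m := m) (by omega) (by omega) (by ring)
      (by ring) (by ring) hlt ?_
    convert h using 2 <;> ring

theorem norm_lt_numReflections_of_neg {w x : Alcove} (ha : w.a < 0) (hb : w.b < 0) {i : Fin 3}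
    {m : ℤ} (hlt : x.norm < (reflect i m x).norm) (hw : LE (reflect i m x) w)
    (h : w.norm < numReflections w (reflect i m x)) : w.norm < numReflections w x :=
  h.trans_le (numReflections_le_of_neg ha hb hlt hw)

theorem norm_lt_numReflections {w x : Alcove} (ha : w.a ≠ 0) (hb : w.b ≠ 0) (hd : w.d ≠ 0)
    {i : Fin 3} {m : ℤ} (hlt : x.norm < (reflect i m x).norm) (hw : LE (reflect i m x) w)
    (h : w.norm < numReflections w (reflect i m x)) : w.norm < numReflections w x := by
  have key {w x : Alcove} {i : Fin 3} {m : ℤ} (hs : 0 < w.a ∧ 0 < w.b ∨ w.a < 0 ∧ w.b < 0)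
      (hlt : x.norm < (reflect i m x).norm) (hw : LE (reflect i m x) w)
      (h : w.norm < numReflections w (reflect i m x)) : w.norm < numReflections w x := by
    rcases hs with ⟨ha, hb⟩ | ⟨ha, hb⟩
    · exact norm_lt_numReflections_of_pos ha hb hlt hw h
    · exact norm_lt_numReflections_of_neg ha hb hlt hw h
  have hlt' : x.rotate.norm < (reflect (i - 1) m x.rotate).norm := by
    rwa [← rotate_reflect, norm_rotate, norm_rotate]
  have hw' : LE (reflect (i - 1) m x.rotate) w.rotate := by
    rw [← rotate_reflect]
    exact hw.rotate
  have h' : w.rotate.norm < numReflections w.rotate (reflect (i - 1) m x.rotate) := by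
    rwa [← rotate_reflect, numReflections_rotate, norm_rotate]
  have hlt'' : x.rotate.rotate.norm < (reflect (i - 1 - 1) m x.rotate.rotate).norm := by
    rwa [← rotate_reflect, norm_rotate x.rotate, norm_rotate (reflect _ m _)]
  have hw'' : LE (reflect (i - 1 - 1) m x.rotate.rotate) w.rotate.rotate := by
    rw [← rotate_reflect]
    exact hw'.rotate
  have h'' : w.rotate.rotate.norm <
      numReflections w.rotate.rotate (reflect (i - 1 - 1) m x.rotate.rotate) := by
    rwa [← rotate_reflect, numReflections_rotate, norm_rotate]
  -- Pigeonhole: of three nonzero integers two share a sign, and a rotation moves them to the first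
  -- two places.
  rcases (show (0 < w.a ∧ 0 < w.b ∨ w.a < 0 ∧ w.b < 0) ∨
    (0 < w.b ∧ 0 < w.d ∨ w.b < 0 ∧ w.d < 0) ∨ (0 < w.d ∧ 0 < w.a ∨ w.d < 0 ∧ w.a < 0) by omega)
    with hs | hs | hs
  · exact key hs hlt hw h
  · have := key (w := w.rotate) hs hlt' hw' h'
    rwa [numReflections_rotate, norm_rotate] at this
  · have := key (w := w.rotate.rotate) hs hlt'' hw'' h''
    rwa [numReflections_rotate, numReflections_rotate, norm_rotate, norm_rotate] at this

end Alcove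
end AffineA2

theorem theoremt {W : Type*} [Group W] (cs : CoxeterSystem AffineA2.matrix W) (w x y : W)
    (hw : ¬ AffineA2.IsSpiral cs w) (hyx : cs.BruhatLE y x) (hxw : cs.BruhatLE x w)
    (hq : 0 < cs.q w x) : 0 < cs.q w y := by
  obtain ⟨ha, hb, hd⟩ := AffineA2.coord_ne_zero_of_not_isSpiral cs hw
  rw [AffineA2.q_eq, sub_pos, Nat.cast_lt] at hq ⊢
  rw [AffineA2.bruhatLE_iff] at hyx hxw
  suffices AffineA2.Alcove.LE (AffineA2.alcove cs y) (AffineA2.alcove cs w) ∧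
      (AffineA2.alcove cs w).norm <
        AffineA2.Alcove.numReflections (AffineA2.alcove cs w) (AffineA2.alcove cs y) from this.2
  generalize AffineA2.alcove cs y = u at hyx ⊢
  induction hyx using Relation.ReflTransGen.head_induction_on with
  | refl => exact ⟨hxw, hq⟩
  | head h _ ih =>
    obtain ⟨i, m, rfl, hlt⟩ := h
    exact ⟨ih.1.head ⟨i, m, rfl, hlt⟩,
      AffineA2.Alcove.norm_lt_numReflections ha hb hd hlt ih.1 ih.2⟩
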